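/- Let $A\in\mathbb{R}^{n\times n}$ and, for $i,j\in\{1,\dots,q\}$, let $C_{ij}\in\mathbb{R}^{m_{ij}\times n}$ with $C_{ii}=0$. Assume: 1. $C_{ij}=C_{ji}$ for all $i,j$ (in particular $m_{ij}=m_{ji}$); 2. the graph on the vertices $1,\dots,q$ in which $i$ and $j$ are adjacent when $C_{ij}\neq 0$ is connected; 3. $A$ is neutrally stable in discrete time: no (complex) eigenvalue of $A$ has magnitude larger than one, and all Jordan blocks of each eigenvalue on the unit circle are one-by-one; 4. for all $i,j$ with $C_{ij}\neq 0$ the pair $(C_{ij},A)$ is detectable in discrete time: no (complex) eigenvector of $A$ with an eigenvalue $\lambda$, $|\lambda|\ge 1$, belongs to the null space of $C_{ij}$. Let $n_1$ be the number of eigenvalues of $A$ on the unit circle, counted with algebraic multiplicity, and $n_2=n-n_1$. Let $U\in\mathbb{R}^{n\times n_1}$ and $W\in\mathbb{R}^{n\times n_2}$ be such that $[U\ \ W]$ is invertible and $$[U\ \ W]^{-1}A\,[U\ \ W]=\begin{bmatrix}Q&0\\0&F\end{bmatrix},$$ where $Q\in\mathbb{R}^{n_1\times n_1}$ is orthogonal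 and all eigenvalues of $F\in\mathbb{R}^{n_2\times n_2}$ lie in the open unit disk. Let $G_{ij}=UQU^{T}C_{ij}^{T}\in\mathbb{R}^{n\times m_{ij}}$ (which means $G_{ij}=0$ when $n_1=0$). Let $L\in\mathbb{R}^{qn_1\times qn_1}$ be the matrix-weighted Laplacian with weights $Q_{ij}=U^{T}C_{ij}^{T}C_{ij}U$, that is, the $q\times q$ block matrix whose $i$th diagonal block is $\sum_{j}Q_{ij}$ and whose $(i,j)$ block is $-Q_{ij}$ for $i\neq j$. Let $\bar\varepsilon>0$ satisfy $L\ge\bar\varepsilon L^{2}$, that is, $L-\bar\varepsilon L^{2}$ is symmetric positive semidefinite. Then for every $\varepsilon\in(0,\bar\varepsilon]$, all solutions of $$x_i(k+1)=Ax_i(k)+\varepsilon\sum_{j=1}^{q}G_{ij}C_{ij}\bigl(x_j(k)-x_i(k)\bigr),\qquad i=1,\dots,q,\quad k=0,1,2,\dots$$ with arbitrary initial conditions $x_1(0),\dots,x_q(0)\in\mathbb{R}^n$ synchronize, i.e. $\|x_i(k)-x_j(k)\|\to 0$ as $k\to\infty$ for all $i,j$, and each $x_i(k)$ remains bounded in $k$.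 -/

import Mathlib

open Matrix Filter Topology

namespace ArraySync

/-- `lam` is an eigenvalue of the real matrix `A` with complex eigenvector `v`. -/
def IsEigenpair {ι : Type*} [Fintype ι] (A : Matrix ι ι ℝ) (lam : ℂ) (v : ι → ℂ) : Prop :=
  v ≠ 0 ∧ A.map Complex.ofReal *ᵥ v = lam • v

/-- `lam` is a (complex) eigenvalue of the real matrix `A`. -/
def IsEigenvalue {ι : Type*} [Fintype ι] (A : Matrix ι ι ℝ) (lam : ℂ) : Prop :=
  ∃ v, IsEigenpair A lam v

/-- Stability in discrete time: all eigenvalues lie in the open unit disk. -/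
def IsStable {ι : Type*} [Fintype ι] (A : Matrix ι ι ℝ) : Prop :=
  ∀ lam : ℂ, IsEigenvalue A lam → ‖lam‖ < 1

/-- Neutral stability in discrete time: no eigenvalue has magnitude larger than one, and all
Jordan blocks of every eigenvalue on the unit circle are one-by-one, that is, every generalized
eigenvector (of any rank) of such an eigenvalue is an ordinary eigenvector. -/
def IsNeutrallyStable {ι : Type*} [Fintype ι] [DecidableEq ι] (A : Matrix ι ι ℝ) : Prop :=
  (∀ lam : ℂ, IsEigenvalue A lam → ‖lam‖ ≤ 1) ∧
  ∀ lam : ℂ, IsEigenvalue A lam → ‖lam‖ = 1 →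
    Module.End.maxGenEigenspace (Matrix.toLin' (A.map Complex.ofReal)) lam =
      Module.End.eigenspace (Matrix.toLin' (A.map Complex.ofReal)) lam

/-- Detectability in discrete time of the pair `(C, A)`: no eigenvector of `A` with eigenvalue on
or outside the unit circle belongs to the null space of `C`. -/
def IsDetectable {ι κ : Type*} [Fintype ι] (C : Matrix κ ι ℝ) (A : Matrix ι ι ℝ) : Prop :=
  ∀ (lam : ℂ) (v : ι → ℂ), 1 ≤ ‖lam‖ → IsEigenpair A lam v → C.map Complex.ofReal *ᵥ v ≠ 0

/-- The number of eigenvalues of `A` on the unit circle, counted with algebraic multiplicity. -/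
noncomputable def unitCircleCount {n : ℕ} (A : Matrix (Fin n) (Fin n) ℝ) : ℕ :=
  open Classical in
  Multiset.card ((A.map Complex.ofReal).charpoly.roots.filter fun lam => ‖lam‖ = 1)

/-- The graph with an edge from `j` to `i` whenever `C i j ≠ 0` (and `i ≠ j`). It is used only for
families with `C i j = C j i` and `C i i = 0`, for which the relation is already symmetric and
irreflexive. -/
def networkGraph {q n : ℕ} {m : Fin q → Fin q → ℕ}
    (C : ∀ i j, Matrix (Fin (m i j)) (Fin n) ℝ) : SimpleGraph (Fin q) :=
  SimpleGraph.fromRel fun j i => C i j ≠ 0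

/-- The standing assumptions on the array `(A, {C i j})`, where `C i j` is of size `m i j × n`. -/
structure ArrayAssumption {q n : ℕ} {m : Fin q → Fin q → ℕ} (A : Matrix (Fin n) (Fin n) ℝ)
    (C : ∀ i j, Matrix (Fin (m i j)) (Fin n) ℝ) : Prop where
  diag : ∀ i, C i i = 0
  /-- `C i j = C j i`; in particular the two matrices have the same size. -/
  symm : ∀ i j, ∃ h : m i j = m j i, C i j = (C j i).submatrix (Fin.cast h) id
  connected : (networkGraph C).Connected
  neutrallyStable : IsNeutrallyStable A
  detectable : ∀ i j, C i j ≠ 0 → IsDetectable (C i j) A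

/-- `G` is a family of gains produced from `A` and `C` by the construction with the choices
`U, W, Q, F`: `[U W]⁻¹ A [U W] = diag(Q, F)` with `Q` orthogonal of size the number of eigenvalues
of `A` on the unit circle and `F` stable, and `G i j = U Q Uᵀ (C i j)ᵀ`. For `n₁ = 0` the matrix
`U` has no columns, so that `G i j = 0`. -/
structure IsGainConstruction {q n n₁ n₂ : ℕ} {m : Fin q → Fin q → ℕ}
    (A : Matrix (Fin n) (Fin n) ℝ) (C : ∀ i j, Matrix (Fin (m i j)) (Fin n) ℝ)
    (U : Matrix (Fin n) (Fin n₁) ℝ) (W : Matrix (Fin n) (Fin n₂) ℝ)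
    (Q : Matrix (Fin n₁) (Fin n₁) ℝ) (F : Matrix (Fin n₂) (Fin n₂) ℝ)
    (G : ∀ i j, Matrix (Fin n) (Fin (m i j)) ℝ) : Prop where
  card_eq : n₁ = unitCircleCount A
  dim_eq : n₁ + n₂ = n
  /-- `V` is the two-sided inverse of `[U W]`. -/
  block : ∃ V : Matrix (Fin n₁ ⊕ Fin n₂) (Fin n) ℝ,
    V * fromCols U W = 1 ∧ fromCols U W * V = 1 ∧
      V * A * fromCols U W = fromBlocks Q 0 0 F
  orthogonal : Q ∈ Matrix.orthogonalGroup (Fin n₁) ℝ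
  stable : IsStable F
  gain : ∀ i j, G i j = U * Q * Uᵀ * (C i j)ᵀ

/-- The matrix-weighted Laplacian of the family of weights `P i j`: the diagonal blocks are
`∑ j, P i j` and the off-diagonal blocks are `-P i j`. -/
def weightedLaplacian {q p : ℕ} (P : Fin q → Fin q → Matrix (Fin p) (Fin p) ℝ) :
    Matrix (Fin q × Fin p) (Fin q × Fin p) ℝ :=
  Matrix.of fun a b => if a.1 = b.1 then (∑ j, P a.1 j) a.2 b.2 else -P a.1 b.1 a.2 b.2

/-- `x k i` is the state of the `i`-th system at time `k`; `x` solves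
`xᵢ⁺ = A xᵢ + uᵢ` under the controls `uᵢ = ε ∑ⱼ Gᵢⱼ Cᵢⱼ (xⱼ - xᵢ)`. -/
def IsSolution {q n : ℕ} {m : Fin q → Fin q → ℕ} (A : Matrix (Fin n) (Fin n) ℝ)
    (C : ∀ i j, Matrix (Fin (m i j)) (Fin n) ℝ) (G : ∀ i j, Matrix (Fin n) (Fin (m i j)) ℝ)
    (ε : ℝ) (x : ℕ → Fin q → Fin n → ℝ) : Prop :=
  ∀ k i, x (k + 1) i = A *ᵥ x k i + ε • ∑ j, G i j *ᵥ (C i j *ᵥ (x k j - x k i))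

/-- The Euclidean norm of a vector. -/
noncomputable def euclNorm {n : ℕ} (v : Fin n → ℝ) : ℝ :=
  ‖(WithLp.toLp 2 v : EuclideanSpace ℝ (Fin n))‖

/-- `‖xᵢ(k) - xⱼ(k)‖ → 0` as `k → ∞`, for all `i, j`. -/
def Synchronizes {q n : ℕ} (x : ℕ → Fin q → Fin n → ℝ) : Prop :=
  ∀ i j, Tendsto (fun k => euclNorm (x k i - x k j)) atTop (𝓝 0)

/-- Every `xᵢ(k)` is bounded in `k`. -/
def RemainsBounded {q n : ℕ} (x : ℕ → Fin q → Fin n → ℝ) : Prop :=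
  ∀ i, ∃ M : ℝ, ∀ k, euclNorm (x k i) ≤ M

end ArraySync

/-! In the coordinates given by `[U W]⁻¹` each state splits into a part `η` governed by `F` and a
part `ξ` governed by `Q`. The gains have range in that of `U`, so `η` is uncoupled and decays
summably; it enters the `ξ`-dynamics only as a summable disturbance.

Stacking the `ξᵢ` into `z`, the undisturbed step is `I - ε L` followed by a blockwise isometry `Q`.
From `L ≥ εbar L²` the squared norm drops by at least `ε ⟨z, L z⟩`. Hence `z` stays bounded and `⟨z,
L z⟩ → 0`, so that `L z → 0` and every relative output `C i j U (ξᵢ - ξⱼ)` tends to zero.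

Each difference `ξᵢ - ξⱼ` then asymptotically follows `Q`. Detectability on an edge makes `(C i j U,
Q)` observable, because `U` maps eigenvectors of `Q` to eigenvectors of `A` on the unit circle. A
vanishing output therefore forces a vanishing difference on each edge, and connectedness extends
this to all pairs. -/

namespace ArraySync

/-! ### Summability of the powers of a stable matrix -/

section Stability

attribute [local instance] Matrix.linftyOpNormedAddCommGroup Matrix.linftyOpNormedRing
  Matrix.linftyOpNormedAlgebra

/-- Gelfand's formula: for `r` strictly between the spectral radius and 1, eventually `‖a ^ k‖ ≤ r ^
k`. -/
theorem summable_norm_pow_of_spectralRadius_lt_one {R : Type*} [NormedRing R] [NormedAlgebra ℂ R]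
    [CompleteSpace R] (a : R) (ha : spectralRadius ℂ a < 1) : Summable fun k : ℕ => ‖a ^ k‖ := by
  obtain ⟨r, har, hr⟩ := exists_between ha
  lift r to NNReal using ne_top_of_lt hr
  have hr1 : (r : ℝ) < 1 := by exact_mod_cast hr
  have hlim := spectrum.pow_nnnorm_pow_one_div_tendsto_nhds_spectralRadius a
  have hev : ∀ᶠ k : ℕ in atTop, ‖(‖a ^ k‖)‖ ≤ (r : ℝ) ^ k := by
    filter_upwards [hlim.eventually_lt_const har, eventually_ge_atTop 1] with k hk hk1
    have hk0 : (0 : ℝ) < k := by exact_mod_cast hk1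
    have h1 := ENNReal.rpow_le_rpow hk.le hk0.le
    rw [← ENNReal.rpow_mul, one_div, inv_mul_cancel₀ hk0.ne', ENNReal.rpow_one,
      ENNReal.rpow_natCast] at h1
    rw [norm_norm]
    exact_mod_cast h1
  exact Summable.of_norm_bounded_eventually_nat
    (summable_geometric_of_lt_one r.2 hr1) hev

theorem ofReal_comp_mulVec {ι κ : Type*} [Fintype ι] (M : Matrix κ ι ℝ) (v : ι → ℝ) :
    Complex.ofReal ∘ (M *ᵥ v) = M.map Complex.ofReal *ᵥ (Complex.ofReal ∘ v) :=
  funext fun i => RingHom.map_mulVec Complex.ofRealHom M v i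

theorem map_ofReal_mul {ι κ l : Type*} [Fintype κ] (M : Matrix l κ ℝ) (N : Matrix κ ι ℝ) :
    (M * N).map Complex.ofReal = M.map Complex.ofReal * N.map Complex.ofReal :=
  Matrix.map_mul (f := Complex.ofRealHom)

theorem map_ofReal_pow {ι : Type*} [Fintype ι] [DecidableEq ι] (M : Matrix ι ι ℝ) (k : ℕ) :
    (M ^ k).map Complex.ofReal = M.map Complex.ofReal ^ k :=
  map_pow (Complex.ofRealHom.mapMatrix) M k

theorem isEigenvalue_of_mem_spectrum {ι : Type*} [Fintype ι] [DecidableEq ι] {A : Matrix ι ι ℝ}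
    {lam : ℂ} (h : lam ∈ spectrum ℂ (A.map Complex.ofReal)) : IsEigenvalue A lam := by
  rw [← Matrix.spectrum_toLin', ← Module.End.hasEigenvalue_iff_mem_spectrum] at h
  obtain ⟨v, hv⟩ := h.exists_hasEigenvector
  exact ⟨v, hv.2, by simpa using hv.apply_eq_smul⟩

theorem IsStable.summable_norm_pow_mulVec {ι : Type*} [Fintype ι] [DecidableEq ι]
    {F : Matrix ι ι ℝ} (hF : IsStable F) (v : ι → ℝ) : Summable fun k : ℕ => ‖F ^ k *ᵥ v‖ := by
  -- The spectral radius bound below needs a nontrivial matrix algebra.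
  rcases isEmpty_or_nonempty ι with hι | hι
  · simp [Subsingleton.elim _ (0 : ι → ℝ)]
  have hrad : spectralRadius ℂ (F.map Complex.ofReal) < 1 := by
    refine spectrum.spectralRadius_lt_of_forall_lt (r := 1) _ fun z hz => ?_
    exact_mod_cast hF z (isEigenvalue_of_mem_spectrum hz)
  refine Summable.of_nonneg_of_le (fun _ => norm_nonneg _) (fun k => ?_)
    ((summable_norm_pow_of_spectralRadius_lt_one _ hrad).mul_right ‖Complex.ofReal ∘ v‖)
  have h1 : ‖F ^ k *ᵥ v‖ = ‖Complex.ofReal ∘ (F ^ k *ᵥ v)‖ := by simp [Pi.norm_def]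
  rw [h1, ofReal_comp_mulVec, map_ofReal_pow]
  exact Matrix.linfty_opNorm_mulVec _ _

end Stability

/-! ### Observability -/

section Observability

variable {ι κ : Type*} [Fintype ι] [DecidableEq ι]

/-- The map `v ↦ (H Q ^ m v)ₘ` is linear and injective on a finite-dimensional space, hence a closed
embedding, so convergence can be tested on its image. -/
theorem tendsto_zero_of_observable {Q : Matrix ι ι ℝ} {H : Matrix κ ι ℝ}
    (hobs : ∀ v, (∀ m : ℕ, H *ᵥ (Q ^ m *ᵥ v) = 0) → v = 0) {v : ℕ → ι → ℝ}
    (hv : ∀ m : ℕ, Tendsto (fun k => H *ᵥ (Q ^ m *ᵥ v k)) atTop (𝓝 0)) :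
    Tendsto v atTop (𝓝 0) := by
  let f : (ι → ℝ) →ₗ[ℝ] (ℕ → κ → ℝ) :=
    LinearMap.pi fun m => H.mulVecLin ∘ₗ (Q ^ m).mulVecLin
  have hf : LinearMap.ker f = ⊥ := LinearMap.ker_eq_bot'.2 fun w hw => hobs w fun m => congrFun hw m
  rw [(LinearMap.isClosedEmbedding_of_injective hf).tendsto_nhds_iff, map_zero, tendsto_pi_nhds]
  exact hv

/-- A nonzero vector in the unobservable subspace yields an unobservable eigenvector. -/
theorem exists_unobservable_eigenpair {Q : Matrix ι ι ℝ} {H : Matrix κ ι ℝ} {v : ι → ℝ}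
    (hv : v ≠ 0) (h : ∀ m : ℕ, H *ᵥ (Q ^ m *ᵥ v) = 0) :
    ∃ lam w, IsEigenpair Q lam w ∧ H.map Complex.ofReal *ᵥ w = 0 := by
  let Qc := Q.map Complex.ofReal
  -- The complex unobservable subspace is invariant under `Q` and contains `v`, so `Q` restricted to
  -- it has an eigenvector.
  let N : Submodule ℂ (ι → ℂ) :=
    ⨅ m : ℕ, LinearMap.ker ((H.map Complex.ofReal).mulVecLin ∘ₗ (Qc ^ m).mulVecLin)
  have hmem : ∀ w, w ∈ N ↔ ∀ m : ℕ, H.map Complex.ofReal *ᵥ (Qc ^ m *ᵥ w) = 0 := by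
    intro w; simp [N, Submodule.mem_iInf]
  have hinv : ∀ w ∈ N, Qc.mulVecLin w ∈ N := by
    intro w hw
    rw [hmem] at hw ⊢
    intro m
    rw [mulVecLin_apply, mulVec_mulVec w, ← pow_succ]
    exact hw (m + 1)
  have hvN : Complex.ofReal ∘ v ∈ N := by
    rw [hmem]
    intro m
    rw [← map_ofReal_pow, ← ofReal_comp_mulVec, ← ofReal_comp_mulVec, h]
    ext; simp
  have hne : (⟨_, hvN⟩ : N) ≠ 0 := by
    intro h0
    refine hv (funext fun i => ?_)
    simpa using congrFun (congrArg Subtype.val h0) i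
  have : Nontrivial N := ⟨_, _, hne⟩
  obtain ⟨lam, hlam⟩ := Module.End.exists_eigenvalue (Qc.mulVecLin.restrict hinv)
  obtain ⟨w, hw⟩ := hlam.exists_hasEigenvector
  refine ⟨lam, w, ⟨fun h0 => hw.2 (Subtype.ext h0), ?_⟩, ?_⟩
  · exact congrArg Subtype.val hw.apply_eq_smul
  · simpa using (hmem _).1 w.2 0

open scoped ComplexOrder in
theorem IsEigenpair.norm_eq_one_of_mem_orthogonalGroup {Q : Matrix ι ι ℝ} {lam : ℂ} {w : ι → ℂ}
    (h : IsEigenpair Q lam w) (hQ : Q ∈ Matrix.orthogonalGroup ι ℝ) : ‖lam‖ = 1 := by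
  obtain ⟨h0, h⟩ := h
  have hQQ : (Q.map Complex.ofReal)ᴴ * Q.map Complex.ofReal = 1 := by
    have h1 : (Q.map Complex.ofReal)ᴴ = Qᵀ.map Complex.ofReal := by
      ext i j; simp [conjTranspose_apply]
    have h2 : Qᵀ * Q = 1 := by
      simpa [star_eq_conjTranspose] using (Matrix.mem_orthogonalGroup_iff' (A := Q) ι ℝ).1 hQ
    rw [h1, ← map_ofReal_mul, h2]
    exact map_one (Complex.ofRealHom.mapMatrix)
  have h1 : star (Q.map Complex.ofReal *ᵥ w) ⬝ᵥ (Q.map Complex.ofReal *ᵥ w) = star w ⬝ᵥ w := by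
    rw [star_mulVec, ← dotProduct_mulVec, mulVec_mulVec, hQQ, one_mulVec]
  rw [h, star_smul, smul_dotProduct, dotProduct_smul, smul_smul, smul_eq_mul] at h1
  have h2 : star lam * lam = 1 :=
    mul_right_cancel₀ (b := star w ⬝ᵥ w) (dotProduct_star_self_eq_zero.not.2 h0) (by rw [h1, one_mul])
  have h3 : ‖lam‖ * ‖lam‖ = 1 := by simpa using congrArg norm h2
  nlinarith [norm_nonneg lam]

end Observability

/-- A nonexpansive recursion with summable perturbations stays bounded, and the decrements of the
squared norm tend to zero. -/
theorem bounded_and_tendsto_zero_of_perturbed_contraction {a d s : ℕ → ℝ} (ha : ∀ k, 0 ≤ a k)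
    (hd0 : ∀ k, 0 ≤ d k) (hd : Summable d) (hs0 : ∀ k, 0 ≤ s k)
    {b : ℕ → ℝ} (hb : ∀ k, b k ^ 2 ≤ a k ^ 2 - s k)
    (hab : ∀ k, a (k + 1) ≤ b k + d k) :
    (∃ B, ∀ k, a k ≤ B) ∧ Tendsto s atTop (𝓝 0) := by
  have hba : ∀ k, b k ≤ a k := fun k => by
    nlinarith [hb k, hs0 k, ha k]
  have hbound : ∀ k, a k ≤ a 0 + ∑ i ∈ Finset.range k, d i := by
    intro k
    induction k with
    | zero => simp
    | succ k ih => rw [Finset.sum_range_succ]; linarith [hab k, hba k]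
  have hB : ∀ k, a k ≤ a 0 + ∑' i, d i := fun k =>
    (hbound k).trans (by gcongr; exact hd.sum_le_tsum _ fun i _ => hd0 i)
  refine ⟨⟨_, hB⟩, ?_⟩
  set B := a 0 + ∑' i, d i
  set D := ∑' i, d i
  have hdD : ∀ k, d k ≤ D := fun k => hd.le_tsum k fun i _ => hd0 i
  -- Expand `(b k + d k) ^ 2` and bound `b k ≤ B`, `d k ≤ D`: the error is linear in `d k`.
  -- Telescoping then bounds the partial sums of `s`.
  have hstep : ∀ k, s k ≤ a k ^ 2 - a (k + 1) ^ 2 + (2 * B + D) * d k := fun k => by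
    have h1 : a (k + 1) ^ 2 ≤ (b k + d k) ^ 2 := by
      have := ha (k + 1); gcongr; exact hab k
    have h2 : b k * d k ≤ B * d k :=
      mul_le_mul_of_nonneg_right ((hba k).trans (hB k)) (hd0 k)
    have h3 : d k * d k ≤ D * d k := mul_le_mul_of_nonneg_right (hdD k) (hd0 k)
    nlinarith [hb k]
  have hsum : ∀ k, ∑ i ∈ Finset.range k, s i ≤
      a 0 ^ 2 - a k ^ 2 + (2 * B + D) * ∑ i ∈ Finset.range k, d i := by
    intro k
    induction k with
    | zero => simp
    | succ k ih => rw [Finset.sum_range_succ, Finset.sum_range_succ]; nlinarith [hstep k]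
  have hD0 : 0 ≤ D := tsum_nonneg hd0
  have hB0 : 0 ≤ B := add_nonneg (ha 0) hD0
  refine (summable_of_sum_range_le (c := a 0 ^ 2 + (2 * B + D) * D) hs0 fun k => ?_).tendsto_atTop_zero
  refine (hsum k).trans ?_
  have : (2 * B + D) * ∑ i ∈ Finset.range k, d i ≤ (2 * B + D) * D :=
    mul_le_mul_of_nonneg_left (hd.sum_le_tsum _ fun i _ => hd0 i) (by positivity)
  nlinarith [sq_nonneg (a k)]

/-! ### The matrix-weighted Laplacian -/

section Laplacian

variable {q p : ℕ} {P : Fin q → Fin q → Matrix (Fin p) (Fin p) ℝ}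

theorem weightedLaplacian_mulVec (hdiag : ∀ i, P i i = 0) (ξ : Fin q → Fin p → ℝ) (i : Fin q)
    (a : Fin p) : (weightedLaplacian P *ᵥ Function.uncurry ξ) (i, a) =
      (∑ j, P i j *ᵥ (ξ i - ξ j)) a := by
  -- Since `P i i = 0`, the term `-P i j` may be included on the diagonal too.
  have hentry : ∀ j b, weightedLaplacian P (i, a) (j, b) =
      (if i = j then (∑ l, P i l) a b else 0) - P i j a b := by
    intro j b
    by_cases h : i = j
    · subst h; simp [weightedLaplacian, hdiag]
    · simp [weightedLaplacian, h]
  have h1 : (∑ j, P i j *ᵥ (ξ i - ξ j)) a = ((∑ j, P i j) *ᵥ ξ i) a - ∑ j, (P i j *ᵥ ξ j) a := by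
    rw [sum_mulVec]
    simp only [mulVec_sub, Finset.sum_sub_distrib, Pi.sub_apply, Finset.sum_apply]
  rw [h1, mulVec, dotProduct, Fintype.sum_prod_type]
  simp only [hentry, Function.uncurry_apply_pair, sub_mul, Finset.sum_sub_distrib, mulVec,
    dotProduct]
  congr 1
  rw [Finset.sum_eq_single i] <;> simp +contextual [eq_comm]

theorem isSymm_weightedLaplacian (hsymm : ∀ i j, P i j = P j i) (hP : ∀ i j, (P i j)ᵀ = P i j) :
    (weightedLaplacian P)ᵀ = weightedLaplacian P := by
  have hPe : ∀ i j a b, P i j a b = P i j b a := fun i j a b => congrFun (congrFun (hP i j) b) a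
  ext ⟨i, a⟩ ⟨j, b⟩
  by_cases h : i = j
  · subst h; simp [weightedLaplacian, Matrix.sum_apply, hPe _ _ a b]
  · simp [weightedLaplacian, h, Ne.symm h, hsymm j i, hPe _ _ a b]

/-- Symmetrization: add the quadratic form to its copy with `i` and `j` exchanged. -/
theorem dotProduct_weightedLaplacian (hdiag : ∀ i, P i i = 0) (hsymm : ∀ i j, P i j = P j i)
    (ξ : Fin q → Fin p → ℝ) :
    2 * (Function.uncurry ξ ⬝ᵥ (weightedLaplacian P *ᵥ Function.uncurry ξ)) =
      ∑ i, ∑ j, (ξ i - ξ j) ⬝ᵥ (P i j *ᵥ (ξ i - ξ j)) := by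
  have h1 : Function.uncurry ξ ⬝ᵥ (weightedLaplacian P *ᵥ Function.uncurry ξ) =
      ∑ i, ∑ j, ξ i ⬝ᵥ (P i j *ᵥ (ξ i - ξ j)) := by
    rw [dotProduct, Fintype.sum_prod_type]
    refine Finset.sum_congr rfl fun i _ => ?_
    rw [← dotProduct_sum]
    simp only [weightedLaplacian_mulVec hdiag]
    rfl
  have h2 : Function.uncurry ξ ⬝ᵥ (weightedLaplacian P *ᵥ Function.uncurry ξ) =
      ∑ i, ∑ j, -(ξ j ⬝ᵥ (P i j *ᵥ (ξ i - ξ j))) := by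
    rw [h1, Finset.sum_comm]
    refine Finset.sum_congr rfl fun i _ => Finset.sum_congr rfl fun j _ => ?_
    rw [hsymm j i, ← neg_sub (ξ i) (ξ j), mulVec_neg, dotProduct_neg]
  rw [two_mul]
  nth_rewrite 1 [h1]
  rw [h2, ← Finset.sum_add_distrib]
  refine Finset.sum_congr rfl fun i _ => ?_
  rw [← Finset.sum_add_distrib]
  refine Finset.sum_congr rfl fun j _ => ?_
  rw [sub_dotProduct, sub_eq_add_neg (_ ⬝ᵥ _)]

/-- If `L ≥ εbar L²` then the step `I - ε L` decreases the squared norm by at least `ε ⟨ξ, L ξ⟩`, and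
`ε |L ξ|² ≤ ⟨ξ, L ξ⟩`. -/
theorem gradient_step_estimates {ι : Type*} [Fintype ι] {L : Matrix ι ι ℝ} (hL : Lᵀ = L)
    {εbar ε : ℝ} (hLε : (L - εbar • (L * L)).PosSemidef) (hε0 : 0 < ε) (hε : ε ≤ εbar)
    (v : ι → ℝ) :
    ε * (L *ᵥ v ⬝ᵥ L *ᵥ v) ≤ v ⬝ᵥ L *ᵥ v ∧
      (v - ε • L *ᵥ v) ⬝ᵥ (v - ε • L *ᵥ v) ≤ v ⬝ᵥ v - ε * (v ⬝ᵥ L *ᵥ v) := by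
  have h1 := hLε.dotProduct_mulVec_nonneg v
  have h2 : v ⬝ᵥ (L * L) *ᵥ v = L *ᵥ v ⬝ᵥ L *ᵥ v := by
    rw [← mulVec_mulVec, dotProduct_mulVec, ← mulVec_transpose, hL]
  rw [star_trivial, sub_mulVec, smul_mulVec, dotProduct_sub, dotProduct_smul, h2, smul_eq_mul] at h1
  have h3 : 0 ≤ L *ᵥ v ⬝ᵥ L *ᵥ v := Finset.sum_nonneg fun i _ => mul_self_nonneg _
  have h4 : ε * (L *ᵥ v ⬝ᵥ L *ᵥ v) ≤ v ⬝ᵥ L *ᵥ v := by nlinarith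
  refine ⟨h4, ?_⟩
  rw [sub_dotProduct, dotProduct_sub, dotProduct_sub, smul_dotProduct, smul_dotProduct,
    dotProduct_smul, dotProduct_smul, dotProduct_comm (L *ᵥ v) v]
  simp only [smul_eq_mul]
  -- The expansion contains `-2 ε ⟨v, L v⟩ + ε² |L v|²`; by `h4` the last term costs at most one of
  -- the two copies.
  nlinarith

end Laplacian

/-! ### Synchronization of the orthogonal subsystems -/

theorem norm_toLp_sq {ι : Type*} [Fintype ι] (v : ι → ℝ) :
    ‖(WithLp.toLp 2 v : EuclideanSpace ℝ ι)‖ ^ 2 = v ⬝ᵥ v := by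
  rw [EuclideanSpace.real_norm_sq_eq]
  simp [dotProduct, sq]

theorem tendsto_zero_of_dotProduct_self {ι : Type*} [Fintype ι] {v : ℕ → ι → ℝ}
    (h : Tendsto (fun k => v k ⬝ᵥ v k) atTop (𝓝 0)) : Tendsto v atTop (𝓝 0) := by
  rw [tendsto_pi_nhds]
  intro i
  rw [Pi.zero_apply, tendsto_zero_iff_abs_tendsto_zero]
  refine squeeze_zero (fun k => abs_nonneg _) (fun k => ?_)
    (by simpa using (Real.continuous_sqrt.tendsto 0).comp h)
  refine Real.abs_le_sqrt ?_
  rw [sq]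
  exact Finset.single_le_sum (f := fun i => v k i * v k i) (fun i _ => mul_self_nonneg _)
    (Finset.mem_univ i)

theorem tendsto_mulVec_zero {ι κ α : Type*} [Fintype ι] {l : Filter α} (M : Matrix κ ι ℝ)
    {v : α → ι → ℝ} (h : Tendsto v l (𝓝 0)) : Tendsto (fun k => M *ᵥ v k) l (𝓝 0) := by
  have := ((continuous_const (y := M)).matrix_mulVec continuous_id).tendsto (0 : ι → ℝ)
  simp only [mulVec_zero, id] at this
  exact this.comp h

/-- An asymptotic trajectory of an observable pair whose output vanishes in the limit tends to
zero. -/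
theorem tendsto_zero_of_output_tendsto_zero {ι κ : Type*} [Fintype ι] [DecidableEq ι]
    {Q : Matrix ι ι ℝ} {H : Matrix κ ι ℝ} (hobs : ∀ v, (∀ m : ℕ, H *ᵥ (Q ^ m *ᵥ v) = 0) → v = 0)
    {v : ℕ → ι → ℝ} (hstep : Tendsto (fun k => v (k + 1) - Q *ᵥ v k) atTop (𝓝 0))
    (hout : Tendsto (fun k => H *ᵥ v k) atTop (𝓝 0)) : Tendsto v atTop (𝓝 0) := by
  refine tendsto_zero_of_observable hobs fun m => ?_
  induction m with
  | zero => simpa using hout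
  -- Uses `H Q ^ (m + 1) v(k) = H Q ^ m v(k + 1) - H Q ^ m (v(k + 1) - Q v(k))`.
  | succ m ih =>
    have h1 := ih.comp (tendsto_add_atTop_nat 1)
    have h2 := tendsto_mulVec_zero H (tendsto_mulVec_zero (Q ^ m) hstep)
    have h3 := h1.sub h2
    rw [sub_zero] at h3
    refine h3.congr fun k => ?_
    simp only [Function.comp_apply, mulVec_sub, sub_sub_cancel, mulVec_mulVec, pow_succ]

theorem dotProduct_mulVec_self_of_mem_orthogonalGroup {ι : Type*} [Fintype ι] [DecidableEq ι]
    {Q : Matrix ι ι ℝ} (hQ : Q ∈ Matrix.orthogonalGroup ι ℝ) (v : ι → ℝ) :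
    (Q *ᵥ v) ⬝ᵥ (Q *ᵥ v) = v ⬝ᵥ v := by
  have h : Qᵀ * Q = 1 := by
    simpa [star_eq_conjTranspose] using (Matrix.mem_orthogonalGroup_iff' (A := Q) ι ℝ).1 hQ
  rw [dotProduct_mulVec, ← mulVec_transpose, mulVec_mulVec, h, one_mulVec]

/-- Synchronization and boundedness of the coupled orthogonal systems
`ξᵢ⁺ = Q (ξᵢ - ε ∑ⱼ Hᵢⱼᵀ Hᵢⱼ (ξᵢ - ξⱼ)) + dᵢ` under summable disturbances. -/
theorem orthogonal_array_synchronizes {q p : ℕ} {m : Fin q → Fin q → ℕ}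
    {Q : Matrix (Fin p) (Fin p) ℝ} (hQ : Q ∈ Matrix.orthogonalGroup (Fin p) ℝ)
    {H : ∀ i j, Matrix (Fin (m i j)) (Fin p) ℝ} (hdiag : ∀ i, H i i = 0)
    (hsymm : ∀ i j, (H i j)ᵀ * H i j = (H j i)ᵀ * H j i)
    {Γ : SimpleGraph (Fin q)} (hΓ : Γ.Connected)
    (hobs : ∀ i j, Γ.Adj i j → ∀ v, (∀ l : ℕ, H i j *ᵥ (Q ^ l *ᵥ v) = 0) → v = 0)
    {L : Matrix (Fin q × Fin p) (Fin q × Fin p) ℝ}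
    (hL : L = weightedLaplacian fun i j => (H i j)ᵀ * H i j)
    {εbar ε : ℝ} (hLε : (L - εbar • (L * L)).PosSemidef) (hε0 : 0 < ε) (hε : ε ≤ εbar)
    {ξ d : ℕ → Fin q → Fin p → ℝ} (hd : ∀ i, Summable fun k => d k i)
    (hξ : ∀ k i, ξ (k + 1) i =
      Q *ᵥ (ξ k i - ε • ∑ j, ((H i j)ᵀ * H i j) *ᵥ (ξ k i - ξ k j)) + d k i) :
    (∃ B, ∀ k i, ‖ξ k i‖ ≤ B) ∧ ∀ i j, Tendsto (fun k => ξ k i - ξ k j) atTop (𝓝 0) := by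
  have hdiag' : ∀ i, (H i i)ᵀ * H i i = 0 := fun i => by simp [hdiag]
  have hLsymm : Lᵀ = L := by
    rw [hL]
    exact isSymm_weightedLaplacian hsymm fun i j => by rw [transpose_mul, transpose_transpose]
  let z : ℕ → Fin q × Fin p → ℝ := fun k => Function.uncurry (ξ k)
  have hLz : ∀ k i a, (L *ᵥ z k) (i, a) =
      (∑ j, ((H i j)ᵀ * H i j) *ᵥ (ξ k i - ξ k j)) a := fun k i a => by
    rw [hL]; exact weightedLaplacian_mulVec hdiag' (ξ k) i a
  let y : ℕ → Fin q → Fin p → ℝ := fun k i =>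
    ξ k i - ε • ∑ j, ((H i j)ᵀ * H i j) *ᵥ (ξ k i - ξ k j)
  have hy : ∀ k, Function.uncurry (y k) = z k - ε • L *ᵥ z k := fun k => by
    ext ⟨i, a⟩
    simp only [Pi.sub_apply, Pi.smul_apply, hLz]
    rfl
  let Y : ℕ → Fin q × Fin p → ℝ := fun k => Function.uncurry fun i => Q *ᵥ y k i
  have hY : ∀ k, Y k ⬝ᵥ Y k = (z k - ε • L *ᵥ z k) ⬝ᵥ (z k - ε • L *ᵥ z k) := fun k => by
    rw [← hy, dotProduct, dotProduct, Fintype.sum_prod_type, Fintype.sum_prod_type]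
    exact Finset.sum_congr rfl fun i _ =>
      dotProduct_mulVec_self_of_mem_orthogonalGroup hQ (y k i)
  have hest := fun k => gradient_step_estimates hLsymm hLε hε0 hε (z k)
  -- The Euclidean norm is used because its square is the quadratic form that the step decreases.
  let N : (Fin q × Fin p → ℝ) → ℝ := fun v => ‖(WithLp.toLp 2 v : EuclideanSpace ℝ _)‖
  have hN : ∀ v, N v ^ 2 = v ⬝ᵥ v := norm_toLp_sq
  have hdN : Summable fun k => N (Function.uncurry (d k)) := by
    refine Summable.norm (f := fun k =>
      (WithLp.toLp 2 (Function.uncurry (d k)) : EuclideanSpace ℝ (Fin q × Fin p))) ?_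
    refine (EuclideanSpace.equiv (Fin q × Fin p) ℝ).symm.summable.2 ?_
    exact Pi.summable.2 fun ⟨i, a⟩ => Pi.summable.1 (hd i) a
  have hz0 : ∀ k, 0 ≤ z k ⬝ᵥ L *ᵥ z k := fun k =>
    (mul_nonneg hε0.le (Finset.sum_nonneg fun i _ => mul_self_nonneg _)).trans (hest k).1
  obtain ⟨⟨B, hB⟩, hs⟩ := bounded_and_tendsto_zero_of_perturbed_contraction
    (a := fun k => N (z k)) (d := fun k => N (Function.uncurry (d k)))
    (s := fun k => ε * (z k ⬝ᵥ L *ᵥ z k)) (b := fun k => N (Y k))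
    (fun k => norm_nonneg _) (fun k => norm_nonneg _) hdN (fun k => mul_nonneg hε0.le (hz0 k))
    (fun k => by rw [hN, hN, hY]; exact (hest k).2)
    (fun k => by
      have h1 : z (k + 1) = Y k + Function.uncurry (d k) := by
        ext ⟨i, a⟩
        exact congrFun (hξ k i) a
      rw [h1]
      exact norm_add_le (WithLp.toLp 2 (Y k) : EuclideanSpace ℝ _) (WithLp.toLp 2 _))
  have hs' : Tendsto (fun k => z k ⬝ᵥ L *ᵥ z k) atTop (𝓝 0) := by
    simpa [hε0.ne'] using hs.const_mul ε⁻¹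
  refine ⟨⟨B, fun k i => ?_⟩, ?_⟩
  · refine (pi_norm_le_iff_of_nonneg ((norm_nonneg _).trans (hB 0))).2 fun a => ?_
    exact (PiLp.norm_apply_le (WithLp.toLp 2 (z k) : EuclideanSpace ℝ _) (i, a)).trans (hB k)
  have hLz0 : Tendsto (fun k => L *ᵥ z k) atTop (𝓝 0) := by
    refine tendsto_zero_of_dotProduct_self (squeeze_zero
      (fun k => Finset.sum_nonneg fun i _ => mul_self_nonneg _) (fun k => ?_)
      (by simpa using hs'.const_mul ε⁻¹))
    rw [le_inv_mul_iff₀ hε0]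
    exact (hest k).1
  have hstep : ∀ i, Tendsto (fun k => ξ (k + 1) i - Q *ᵥ ξ k i) atTop (𝓝 0) := fun i => by
    have h1 : Tendsto (fun k => ∑ j, ((H i j)ᵀ * H i j) *ᵥ (ξ k i - ξ k j)) atTop (𝓝 0) := by
      rw [tendsto_pi_nhds] at hLz0 ⊢
      intro a
      exact (hLz0 (i, a)).congr fun k => hLz k i a
    have h2 := ((tendsto_mulVec_zero Q h1).const_smul (-ε)).add (hd i).tendsto_atTop_zero
    rw [smul_zero, zero_add] at h2
    refine h2.congr fun k => ?_
    rw [hξ, mulVec_sub, mulVec_smul, neg_smul]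
    abel
  -- The squared outputs are nonnegative summands of `2 ⟨z, L z⟩`.
  have hout : ∀ i j, Tendsto (fun k => H i j *ᵥ (ξ k i - ξ k j)) atTop (𝓝 0) := fun i j => by
    refine tendsto_zero_of_dotProduct_self (squeeze_zero
      (fun k => Finset.sum_nonneg fun i _ => mul_self_nonneg _) (fun k => ?_)
      (by simpa using hs'.const_mul 2))
    have h1 : ∀ i j, (ξ k i - ξ k j) ⬝ᵥ ((H i j)ᵀ * H i j) *ᵥ (ξ k i - ξ k j) =
        H i j *ᵥ (ξ k i - ξ k j) ⬝ᵥ H i j *ᵥ (ξ k i - ξ k j) := fun i j => by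
      rw [← mulVec_mulVec, dotProduct_mulVec, vecMul_transpose]
    have h0 : ∀ i j, 0 ≤ H i j *ᵥ (ξ k i - ξ k j) ⬝ᵥ H i j *ᵥ (ξ k i - ξ k j) := fun i j =>
      Finset.sum_nonneg fun i _ => mul_self_nonneg _
    have h2 := dotProduct_weightedLaplacian hdiag' hsymm (ξ k)
    simp only [h1] at h2
    rw [hL, h2]
    exact (Finset.single_le_sum (fun j _ => h0 i j) (Finset.mem_univ j)).trans
      (Finset.single_le_sum
        (f := fun i => ∑ j, H i j *ᵥ (ξ k i - ξ k j) ⬝ᵥ H i j *ᵥ (ξ k i - ξ k j))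
        (fun i _ => Finset.sum_nonneg fun j _ => h0 i j) (Finset.mem_univ i))
  have hadj : ∀ i j, Γ.Adj i j → Tendsto (fun k => ξ k i - ξ k j) atTop (𝓝 0) := fun i j hij => by
    refine tendsto_zero_of_output_tendsto_zero (hobs i j hij) ?_ (hout i j)
    have h := (hstep i).sub (hstep j)
    rw [sub_zero] at h
    refine h.congr fun k => ?_
    rw [mulVec_sub]
    abel
  intro i j
  obtain ⟨w⟩ := hΓ.preconnected i j
  induction w with
  | nil => simp
  | cons h _ ih => simpa using (hadj _ _ h).add ih

section Norm

variable {n : ℕ}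

theorem tendsto_euclNorm_zero {v : ℕ → Fin n → ℝ} (h : Tendsto v atTop (𝓝 0)) :
    Tendsto (fun k => euclNorm (v k)) atTop (𝓝 0) := by
  have h1 := ((EuclideanSpace.equiv (Fin n) ℝ).symm.continuous.tendsto 0).comp h
  rw [map_zero] at h1
  exact tendsto_zero_iff_norm_tendsto_zero.1 h1

theorem exists_euclNorm_mulVec_le {p : ℕ} (M : Matrix (Fin n) (Fin p) ℝ) :
    ∃ c, 0 ≤ c ∧ ∀ v, euclNorm (M *ᵥ v) ≤ c * ‖v‖ := by
  let f : (Fin p → ℝ) →L[ℝ] EuclideanSpace ℝ (Fin n) :=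
    ((EuclideanSpace.equiv (Fin n) ℝ).symm : _ →L[ℝ] _) ∘L M.mulVecLin.toContinuousLinearMap
  exact ⟨‖f‖, norm_nonneg _, f.le_opNorm⟩

end Norm

/-- The two matrices differ only by a relabelling of rows, over which the Gram product sums. -/
theorem ArrayAssumption.gram_symm {q n : ℕ} {m : Fin q → Fin q → ℕ} {A : Matrix (Fin n) (Fin n) ℝ}
    {C : ∀ i j, Matrix (Fin (m i j)) (Fin n) ℝ} (h : ArrayAssumption A C) (i j : Fin q) :
    (C i j)ᵀ * C i j = (C j i)ᵀ * C j i := by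
  obtain ⟨hm, hC⟩ := h.symm i j
  rw [hC, transpose_submatrix]
  exact Matrix.submatrix_mul_equiv (C j i)ᵀ (C j i) id (finCongr hm) id

theorem ArrayAssumption.ne_zero_of_adj {q n : ℕ} {m : Fin q → Fin q → ℕ}
    {A : Matrix (Fin n) (Fin n) ℝ} {C : ∀ i j, Matrix (Fin (m i j)) (Fin n) ℝ}
    (h : ArrayAssumption A C) {i j : Fin q} (hij : (networkGraph C).Adj i j) : C i j ≠ 0 := by
  rcases ((SimpleGraph.fromRel_adj _ _ _).1 hij).2 with h1 | h1
  · intro h0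
    obtain ⟨hm, hC⟩ := h.symm j i
    rw [h0] at hC
    exact h1 hC
  · exact h1

end ArraySync

/-! ### Reduction to the orthogonal subsystems -/

open ArraySync in
theorem mainTheorem3 {q n n₁ n₂ : ℕ} {m : Fin q → Fin q → ℕ}
    (A : Matrix (Fin n) (Fin n) ℝ) (C : ∀ i j, Matrix (Fin (m i j)) (Fin n) ℝ)
    (hAC : ArraySync.ArrayAssumption A C)
    (U : Matrix (Fin n) (Fin n₁) ℝ) (W : Matrix (Fin n) (Fin n₂) ℝ)
    (Q : Matrix (Fin n₁) (Fin n₁) ℝ) (F : Matrix (Fin n₂) (Fin n₂) ℝ)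
    (G : ∀ i j, Matrix (Fin n) (Fin (m i j)) ℝ)
    (hG : ArraySync.IsGainConstruction A C U W Q F G)
    (L : Matrix (Fin q × Fin n₁) (Fin q × Fin n₁) ℝ)
    (hL : L = ArraySync.weightedLaplacian fun i j => Uᵀ * (C i j)ᵀ * C i j * U)
    (εbar : ℝ) (hεbar : 0 < εbar) (hLε : (L - εbar • (L * L)).PosSemidef)
    (ε : ℝ) (hε : ε ∈ Set.Ioc 0 εbar) :
    ∀ x : ℕ → Fin q → Fin n → ℝ, ArraySync.IsSolution A C G ε x →
      ArraySync.Synchronizes x ∧ ArraySync.RemainsBounded x := by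
  intro x hx
  obtain ⟨V, hVl, hVr, hVA⟩ := hG.block
  obtain ⟨V₁, V₂, rfl⟩ : ∃ V₁ V₂, V = fromRows V₁ V₂ := ⟨_, _, (fromRows_toRows V).symm⟩
  rw [fromRows_mul_fromCols, ← fromBlocks_one, fromBlocks_inj] at hVl
  rw [fromCols_mul_fromRows] at hVr
  rw [fromRows_mul, fromRows_mul_fromCols, fromBlocks_inj] at hVA
  obtain ⟨hV₁U, hV₁W, hV₂U, hV₂W⟩ := hVl
  obtain ⟨hQ, hQW, hFU, hF⟩ := hVA
  have hV₁A : V₁ * A = Q * V₁ := by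
    rw [← Matrix.mul_one (V₁ * A), ← hVr, Matrix.mul_add, ← Matrix.mul_assoc, hQ,
      ← Matrix.mul_assoc, hQW, Matrix.zero_mul, add_zero]
  have hV₂A : V₂ * A = F * V₂ := by
    rw [← Matrix.mul_one (V₂ * A), ← hVr, Matrix.mul_add, ← Matrix.mul_assoc, hFU,
      ← Matrix.mul_assoc, hF, Matrix.zero_mul, zero_add]
  have hAU : A * U = U * Q := by
    rw [← Matrix.one_mul (A * U), ← hVr, Matrix.add_mul, Matrix.mul_assoc, Matrix.mul_assoc,
      ← Matrix.mul_assoc V₁, ← Matrix.mul_assoc V₂, hQ, hFU, Matrix.mul_zero, add_zero]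
  let ξ : ℕ → Fin q → Fin n₁ → ℝ := fun k i => V₁ *ᵥ x k i
  let η : ℕ → Fin q → Fin n₂ → ℝ := fun k i => V₂ *ᵥ x k i
  have hsplit : ∀ k i, x k i = U *ᵥ ξ k i + W *ᵥ η k i := fun k i => by
    simp only [ξ, η, mulVec_mulVec, ← add_mulVec, hVr, one_mulVec]
  have hη : ∀ k i, η k i = F ^ k *ᵥ η 0 i := by
    intro k i
    induction k with
    | zero => simp
    | succ k ih =>
      -- The coupling is invisible to `η`: each gain starts with `U`, and `V₂ * U = 0`.
      have h0 : ∀ j, V₂ *ᵥ (G i j *ᵥ (C i j *ᵥ (x k j - x k i))) = 0 := fun j => by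
        rw [hG.gain, mulVec_mulVec]
        simp only [← Matrix.mul_assoc, hV₂U, Matrix.zero_mul, zero_mulVec]
      have h1 : η (k + 1) i = F *ᵥ η k i := by
        simp only [η]
        rw [hx k i, mulVec_add, mulVec_smul, mulVec_sum, Finset.sum_eq_zero fun j _ => h0 j,
          smul_zero, add_zero, mulVec_mulVec, mulVec_mulVec, hV₂A]
      rw [h1, ih, mulVec_mulVec, ← pow_succ']
  have hηsum : ∀ i, Summable fun k => η k i := fun i => by
    rw [funext fun k => hη k i]
    exact (hG.stable.summable_norm_pow_mulVec _).of_norm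
  let H : ∀ i j, Matrix (Fin (m i j)) (Fin n₁) ℝ := fun i j => C i j * U
  have hH : ∀ i j, (H i j)ᵀ * H i j = Uᵀ * (C i j)ᵀ * C i j * U := fun i j => by
    simp only [H, transpose_mul, Matrix.mul_assoc]
  -- An unobservable eigenvector `w` of `Q` would give the eigenvector `U w` of `A`, nonzero as `V₁
  -- * U = 1`, with eigenvalue on the unit circle and killed by `C i j`.
  have hobs : ∀ i j, (networkGraph C).Adj i j →
      ∀ v, (∀ l : ℕ, H i j *ᵥ (Q ^ l *ᵥ v) = 0) → v = 0 := by
    intro i j hij v hv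
    by_contra hv0
    obtain ⟨lam, w, hw, hHw⟩ := exists_unobservable_eigenpair hv0 hv
    have hlam := hw.norm_eq_one_of_mem_orthogonalGroup hG.orthogonal
    have hUw : IsEigenpair A lam (U.map Complex.ofReal *ᵥ w) := by
      refine ⟨fun h0 => hw.1 ?_, ?_⟩
      · have h1 := congrArg (V₁.map Complex.ofReal *ᵥ ·) h0
        simp only [mulVec_mulVec, ← map_ofReal_mul, hV₁U, mulVec_zero] at h1
        rwa [show (1 : Matrix (Fin n₁) (Fin n₁) ℝ).map Complex.ofReal = 1 from
          map_one Complex.ofRealHom.mapMatrix, one_mulVec] at h1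
      · rw [mulVec_mulVec, ← map_ofReal_mul, hAU, map_ofReal_mul, ← mulVec_mulVec, hw.2,
          mulVec_smul]
    refine hAC.detectable i j (hAC.ne_zero_of_adj hij) lam _ hlam.ge hUw ?_
    rw [mulVec_mulVec, ← map_ofReal_mul]
    exact hHw
  -- The contribution of the `W`-components of the states to the relative measurements.
  let d : ℕ → Fin q → Fin n₁ → ℝ := fun k i =>
    ε • ∑ j, (Q * Uᵀ * (C i j)ᵀ * C i j * W) *ᵥ (η k j - η k i)
  have hd : ∀ i, Summable fun k => d k i := fun i => by
    refine Summable.const_smul ε (summable_sum fun j _ => ?_)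
    exact ((hηsum j).sub (hηsum i)).map
      (Q * Uᵀ * (C i j)ᵀ * C i j * W).mulVecLin
      (LinearMap.continuous_of_finiteDimensional _)
  have hξ : ∀ k i, ξ (k + 1) i =
      Q *ᵥ (ξ k i - ε • ∑ j, ((H i j)ᵀ * H i j) *ᵥ (ξ k i - ξ k j)) + d k i := by
    intro k i
    have h1 : ∀ j, V₁ *ᵥ (G i j *ᵥ (C i j *ᵥ (x k j - x k i))) =
        -(Q *ᵥ (((H i j)ᵀ * H i j) *ᵥ (ξ k i - ξ k j))) +
          (Q * Uᵀ * (C i j)ᵀ * C i j * W) *ᵥ (η k j - η k i) := fun j => by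
      have h2 : x k j - x k i = U *ᵥ (ξ k j - ξ k i) + W *ᵥ (η k j - η k i) := by
        rw [hsplit k j, hsplit k i, mulVec_sub, mulVec_sub]
        abel
      rw [h2, ← mulVec_neg, ← mulVec_neg, neg_sub, hG.gain, hH]
      simp only [mulVec_add, mulVec_mulVec, ← Matrix.mul_assoc, hV₁U, Matrix.one_mul]
    have h3 : ξ (k + 1) i = Q *ᵥ ξ k i +
        ε • ∑ j, V₁ *ᵥ (G i j *ᵥ (C i j *ᵥ (x k j - x k i))) := by
      simp only [ξ]
      rw [hx k i, mulVec_add, mulVec_smul, mulVec_sum, mulVec_mulVec, mulVec_mulVec, hV₁A]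
    rw [h3]
    simp only [h1, d]
    rw [Finset.sum_add_distrib, Finset.sum_neg_distrib, ← mulVec_sum, smul_add, smul_neg,
      mulVec_sub, mulVec_smul, sub_eq_add_neg, add_assoc]
  obtain ⟨⟨B, hB⟩, hsync⟩ := orthogonal_array_synchronizes hG.orthogonal (H := H)
    (fun i => by simp only [H, hAC.diag, Matrix.zero_mul])
    (fun i j => by rw [hH, hH, Matrix.mul_assoc Uᵀ, hAC.gram_symm i j, ← Matrix.mul_assoc Uᵀ])
    hAC.connected hobs (by simp only [hH]; exact hL) hLε hε.1 hε.2 hd hξ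
  have hη0 : ∀ i, Tendsto (fun k => η k i) atTop (𝓝 0) := fun i => (hηsum i).tendsto_atTop_zero
  refine ⟨fun i j => tendsto_euclNorm_zero ?_, fun i => ?_⟩
  · have h := (tendsto_mulVec_zero U (hsync i j)).add
      (tendsto_mulVec_zero W (by simpa using (hη0 i).sub (hη0 j)))
    rw [add_zero] at h
    refine h.congr fun k => ?_
    rw [hsplit k i, hsplit k j, mulVec_sub, mulVec_sub]
    abel
  · obtain ⟨B', hB'⟩ := (hη0 i).norm.bddAbove_range
    obtain ⟨c, hc, hcU⟩ := exists_euclNorm_mulVec_le U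
    obtain ⟨c', hc', hcW⟩ := exists_euclNorm_mulVec_le W
    refine ⟨c * B + c' * B', fun k => ?_⟩
    rw [hsplit k i]
    refine (norm_add_le (WithLp.toLp 2 (U *ᵥ ξ k i) : EuclideanSpace ℝ (Fin n))
      (WithLp.toLp 2 (W *ᵥ η k i))).trans (add_le_add ((hcU _).trans ?_) ((hcW _).trans ?_))
    · exact mul_le_mul_of_nonneg_left (hB k i) hc
    · exact mul_le_mul_of_nonneg_left (hB' ⟨k, rfl⟩) hc'
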